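/- Let $\Gamma$ be a finite abstract simplicial complex with vertex set $V$ (every element of $V$ is a vertex of $\Gamma$), and let $s$ be a positive integer. The dimension of a face $X$ is $|X|-1$, and the dimension of a complex is the maximum of the dimensions of its faces (so it is $-1$ for the complex without vertices). The $s$-chromatic polynomial $\chi_s(\Gamma;t)$ is the unique polynomial in $t$ whose value at each positive integer $t$ is the number of maps $f:V\to\{1,\dots,t\}$ such that every face of $\Gamma$ contains at most $s$ vertices of any given color. Let $\Gamma^{(1)}$ be the 1-skeleton of $\Gamma$, viewed as a simple graph on $V$. A flat of $\Gamma^{(1)}$ is a set $F$ of edges of $\Gamma^{(1)}$ such that every connected component of the graph $(V,F)$ is an induced subgraph of $\Gamma^{(1)}$; write $\mathcal F(\Gamma^{(1)})$ for the set of flats. For a flat $F$, let $c(F)$ be the number of connected components of $(V,F)$, let $\Gamma^{(1)}/F$ be the graph obtained from $\Gamma^{(1)}$ by contracting the edges in $F$, and let $\Gamma_{V,F}$ be the subcomplex of $\Gamma$ with vertex set $V$ whose faces are the faces of $\Gamma$ all of whose edges lie in $F$. Let $a(G)$ denote the number of acyclic orientations of a graph $G$. Then $$\chi_s(\Gamma;-1)=\sum_{\substack{F\in\mathcal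 F(\Gamma^{(1)})\\ \dim\Gamma_{V,F}<s}}(-1)^{c(F)}\,a(\Gamma^{(1)}/F).$$ -/

import Mathlib

namespace SimpleGraph

/-- A flat of `G`: a set `F` of edges of `G` such that every connected component of the graph
`(V, F)` is an induced subgraph of `G`. -/
def IsFlat {V : Type*} (G : SimpleGraph V) (F : Set (Sym2 V)) : Prop :=
  F ⊆ G.edgeSet ∧
    ∀ C : (fromEdgeSet F).ConnectedComponent,
      (fromEdgeSet F).induce C.supp = G.induce C.supp

/-- The set of flats of a finite graph. -/
noncomputable def flats {V : Type*} [Finite V] (G : SimpleGraph V) : Finset (Set (Sym2 V)) :=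
  (Set.toFinite {F : Set (Sym2 V) | G.IsFlat F}).toFinset

/-- `c(F)`: the number of connected components of the graph `(V, F)`. -/
noncomputable def numComponents {V : Type*} (F : Set (Sym2 V)) : ℕ :=
  Nat.card (fromEdgeSet F).ConnectedComponent

/-- `G / F`: the vertices are the connected components of `(V, F)`, and two distinct ones are
adjacent if some edge of `G` joins them. (Parallel edges are merged: in an acyclic orientation
they all point the same way, so this does not affect the number of acyclic orientations. Loops do
not arise when `F` is a flat.) -/
def contractEdges {V : Type*} (G : SimpleGraph V) (F : Set (Sym2 V)) :
    SimpleGraph (fromEdgeSet F).ConnectedComponent :=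
  G.map (fromEdgeSet F).connectedComponentMk

/-- `D` is an orientation of `G`: each edge of `G` receives exactly one of its two directions,
and `D` has no other arcs. -/
def IsOrientation {V : Type*} (G : SimpleGraph V) (D : Digraph V) : Prop :=
  (∀ u v, D.Adj u v → G.Adj u v) ∧ ∀ u v, G.Adj u v → Xor (D.Adj u v) (D.Adj v u)

/-- `a(G)`: the number of orientations of `G` without directed cycles. -/
noncomputable def numAcyclicOrientations {V : Type*} (G : SimpleGraph V) : ℕ :=
  Nat.card {D : Digraph V // G.IsOrientation D ∧ ∀ v, ¬ Relation.TransGen D.Adj v v}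

end SimpleGraph

namespace AbstractSimplicialComplex

/-! A finite simplicial complex with vertex set `V` is an `AbstractSimplicialComplex V` with `V`
finite. (In Mathlib the empty face is left implicit and every `v : V` is a vertex.) -/

/-- The dimension of a finite complex: the largest number of vertices of a face, minus one. The
complex without vertices has dimension `-1`, the dimension of its only face `∅`. -/
noncomputable def dim {V : Type*} (Γ : AbstractSimplicialComplex V) : ℤ :=
  ((sSup (Finset.card '' Γ.faces) : ℕ) : ℤ) - 1

/-- The 1-skeleton `Γ⁽¹⁾`, as a simple graph on the vertex set. -/
def oneSkeleton {V : Type*} [DecidableEq V] (Γ : AbstractSimplicialComplex V) :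
    SimpleGraph V where
  Adj u v := u ≠ v ∧ ({u, v} : Finset V) ∈ Γ.faces
  symm.symm u v h := ⟨h.1.symm, by rw [Finset.pair_comm]; exact h.2⟩
  loopless := ⟨fun _ h => h.1 rfl⟩

/-- `Γ_{V,F}`: the subcomplex with vertex set `V` whose faces are the faces of `Γ` all of whose
edges lie in `F`. -/
def edgeSubcomplex {V : Type*} (Γ : AbstractSimplicialComplex V) (F : Set (Sym2 V)) :
    AbstractSimplicialComplex V where
  faces := {X | X ∈ Γ.faces ∧ ∀ u ∈ X, ∀ v ∈ X, u ≠ v → s(u, v) ∈ F}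
  isRelLowerSet_faces := by
    rintro X ⟨hX, hF⟩
    refine ⟨(Γ.isRelLowerSet_faces hX).1, fun Y hYX hY => ?_⟩
    exact ⟨(Γ.isRelLowerSet_faces hX).2 hYX hY, fun u hu v hv => hF u (hYX hu) v (hYX hv)⟩
  singleton_mem v := by
    refine ⟨Γ.singleton_mem v, fun u hu w hw huw => ?_⟩
    rw [Finset.mem_singleton] at hu hw
    exact absurd (hu.trans hw.symm) huw

/-- An `s`-simplicial coloring: each face contains at most `s` vertices of any given color. -/
def IsSimplicialColoring {V C : Type*} [DecidableEq C] (Γ : AbstractSimplicialComplex V) (s : ℕ)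
    (f : V → C) : Prop :=
  ∀ X ∈ Γ.faces, ∀ i : C, (X.filter (fun v => f v = i)).card ≤ s

/-- The number of `s`-simplicial colorings with `t` colors. -/
noncomputable def numSimplicialColorings {V : Type*} (Γ : AbstractSimplicialComplex V)
    (s t : ℕ) : ℕ :=
  Nat.card {f : V → Fin t // Γ.IsSimplicialColoring s f}

/-- The number of `s`-simplicial colorings is a polynomial function of the number of colors. -/
theorem exists_polynomial_numSimplicialColorings {V : Type*} [Finite V]
    (Γ : AbstractSimplicialComplex V) (s : ℕ) :
    ∃ p : Polynomial ℤ, ∀ t : ℕ, p.eval (t : ℤ) = (Γ.numSimplicialColorings s t : ℤ) := by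
  classical
  have := Fintype.ofFinite V
  have : Finite (Setoid V) :=
    Finite.of_injective (fun r : Setoid V => r.r) (fun r r' h => Setoid.ext fun a b => by
      exact iff_of_eq (congrFun (congrFun h a) b))
  have := Fintype.ofFinite (Setoid V)
  let good : Setoid V → Prop := fun r => Γ.IsSimplicialColoring s (Quotient.mk r)
  refine ⟨∑ r : Setoid V, if good r then descPochhammer ℤ (Fintype.card (Quotient r)) else 0,
    fun t => ?_⟩
  have key : ∀ f : V → Fin t, Γ.IsSimplicialColoring s f ↔ good (Setoid.ker f) := by
    intro f
    constructor
    · intro h X hX i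
      induction i using Quotient.inductionOn with
      | h a =>
        refine le_trans (le_of_eq ?_) (h X hX (f a))
        congr 1
        ext v
        simp only [Finset.mem_filter]
        rw [Quotient.eq (r := Setoid.ker f)]
        rfl
    · intro h X hX i
      by_cases hi : ∃ a, f a = i
      · obtain ⟨a, rfl⟩ := hi
        refine le_trans (le_of_eq ?_) (h X hX (Quotient.mk (Setoid.ker f) a))
        congr 1
        ext v
        simp only [Finset.mem_filter]
        rw [Quotient.eq (r := Setoid.ker f)]
        rfl
      · rw [Finset.filter_false_of_mem fun v _ hv => hi ⟨v, hv⟩]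
        simp
  have fib : ∀ r : Setoid V,
      Fintype.card {f : V → Fin t // Setoid.ker f = r} =
        t.descFactorial (Fintype.card (Quotient r)) := by
    intro r
    have e : {f : V → Fin t // Setoid.ker f = r} ≃ (Quotient r ↪ Fin t) :=
      { toFun := fun f =>
          ⟨Quotient.lift f.1 (fun a b hab => by
              have : (Setoid.ker f.1) a b := by rw [f.2]; exact hab
              exact this), by
            intro a b
            induction a using Quotient.inductionOn
            induction b using Quotient.inductionOn
            rename_i a b
            intro hab
            apply Quotient.sound
            have h : (Setoid.ker f.1) a b := hab
            rw [f.2] at h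
            exact h⟩
        invFun := fun g => ⟨fun v => g (Quotient.mk r v), by
          ext a b
          rw [Setoid.ker_def, g.injective.eq_iff]
          exact Quotient.eq⟩
        left_inv := fun f => rfl
        right_inv := fun g => by
          ext a
          induction a using Quotient.inductionOn
          rfl }
    rw [Fintype.card_congr e, Fintype.card_embedding_eq, Fintype.card_fin]
  rw [numSimplicialColorings, Nat.card_eq_fintype_card, Fintype.card_subtype,
    Finset.card_eq_sum_card_fiberwise (f := fun f : V → Fin t => Setoid.ker f)
      (t := Finset.univ) (by simp)]
  rw [Polynomial.eval_finsetSum, Nat.cast_sum]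
  refine Finset.sum_congr rfl fun r _ => ?_
  rw [Finset.filter_filter]
  by_cases hr : good r
  · rw [if_pos hr, descPochhammer_eval_eq_descFactorial, ← fib r, Fintype.card_subtype]
    congr 2
    ext f
    simp only [Finset.mem_filter, Finset.mem_univ, true_and, key]
    constructor
    · rintro rfl
      exact ⟨hr, rfl⟩
    · exact fun h => h.2
  · rw [if_neg hr, Polynomial.eval_zero, Finset.filter_false_of_mem]
    · simp
    · rintro f - ⟨h, rfl⟩
      exact hr ((key f).1 h)

/-- The `s`-chromatic polynomial `χ_s(Γ; t)`: the polynomial whose value at each `t : ℕ` is the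
number of `s`-simplicial colorings of `Γ` with `t` colors. -/
noncomputable def sChromaticPolynomial {V : Type*} [Finite V] (Γ : AbstractSimplicialComplex V)
    (s : ℕ) : Polynomial ℤ :=
  (Γ.exists_polynomial_numSimplicialColorings s).choose

theorem sChromaticPolynomial_eval_natCast {V : Type*} [Finite V]
    (Γ : AbstractSimplicialComplex V) (s t : ℕ) :
    (Γ.sChromaticPolynomial s).eval (t : ℤ) = (Γ.numSimplicialColorings s t : ℤ) :=
  (Γ.exists_polynomial_numSimplicialColorings s).choose_spec t

/-- The defining property determines the `s`-chromatic polynomial, already on positive `t`. -/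
theorem eq_sChromaticPolynomial {V : Type*} [Finite V] (Γ : AbstractSimplicialComplex V) (s : ℕ)
    (p : Polynomial ℤ)
    (hp : ∀ t : ℕ, 1 ≤ t → p.eval (t : ℤ) = (Γ.numSimplicialColorings s t : ℤ)) :
    p = Γ.sChromaticPolynomial s := by
  refine Polynomial.eq_of_infinite_eval_eq _ _ (Set.Infinite.mono ?_
    (Set.infinite_range_of_injective (f := fun t : ℕ => ((t + 1 : ℕ) : ℤ))
      (fun a b h => by simpa using h)))
  rintro _ ⟨t, rfl⟩
  exact (hp (t + 1) (by omega)).trans (Γ.sChromaticPolynomial_eval_natCast s (t + 1)).symm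

end AbstractSimplicialComplex

/-! Sort the colorings by their set `F` of monochromatic edges in the 1-skeleton. This set is a
flat. It alone decides whether the coloring is admissible, since the vertices of one color in a face
form a face with all edges in `F` (`isSimplicialColoring_iff_dim_lt`). Colorings with a given `F`
are the proper colorings of the contraction by `F` (`IsFlat.coloringEquiv`). So the `s`-chromatic
polynomial is a sum of chromatic polynomials of contractions, and Stanley's theorem evaluates each
at `-1`; the contraction by `F` has `c(F)` vertices.

Stanley's theorem follows by induction on the number of vertices from two parallel recursions over
independent sets `S`: removing one color class gives `χ(H; t + 1) = ∑ χ(H - S; t)`, and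
inclusion-exclusion over sinks gives `∑ (-1)^|S| a(H - S) = 0` for nonempty `H`. -/

namespace SimpleGraph

/-! ### Proper colorings -/

variable {W : Type*}

/-- Sending a coloring with one extra color `none` to the class of that color and the coloring of
the remaining vertices. -/
noncomputable def coloringOptionEquiv (H : SimpleGraph W) (α : Type*) (S : Finset W)
    (hS : H.IsIndepSet (S : Set W)) :
    {f : H.Coloring (Option α) // ∀ w, f w = none ↔ w ∈ S} ≃
      (H.induce ((S : Set W)ᶜ)).Coloring α where
  toFun f := Coloring.mk
    (fun w => (f.1 w).get (Option.isSome_iff_ne_none.2 fun h => w.2 ((f.2 _).1 h)))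
    (fun {u v} huv h => f.1.valid (v := u) (w := v) huv (Option.get_inj.1 h))
  invFun g := ⟨Coloring.mk
      (by classical exact fun w => if h : w ∈ S then none else some (g ⟨w, h⟩)) (by
        intro u v huv
        by_cases hu : u ∈ S <;> by_cases hv : v ∈ S
        · exact absurd huv (hS hu hv huv.ne)
        · simp [hu, hv]
        · simp [hu, hv]
        · simpa [hu, hv] using g.valid (v := ⟨u, hu⟩) (w := ⟨v, hv⟩) huv), by
      intro w
      by_cases h : w ∈ S
      · exact iff_of_true (dif_pos h) h
      · exact iff_of_false (fun h' => Option.some_ne_none _ ((dif_neg h).symm.trans h')) h⟩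
  left_inv f := by
    apply Subtype.ext
    apply RelHom.ext
    intro w
    by_cases h : w ∈ S
    · exact (dif_pos h).trans ((f.2 w).2 h).symm
    · exact (dif_neg h).trans (Option.some_get _)
  right_inv g := by
    apply RelHom.ext
    rintro ⟨w, h⟩
    apply Option.some_injective
    exact (Option.some_get _).trans (dif_neg h)

instance finite_coloring [Finite W] (H : SimpleGraph W) (α : Type*) [Finite α] :
    Finite (H.Coloring α) :=
  Finite.of_injective (fun f : H.Coloring α => (f : W → α)) DFunLike.coe_injective

open Classical in
/-- The independent sets of vertices of a finite graph. -/
noncomputable def indepFinsets [Fintype W] (H : SimpleGraph W) : Finset (Finset W) :=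
  Finset.univ.filter fun S => H.IsIndepSet (S : Set W)

theorem mem_indepFinsets [Fintype W] {H : SimpleGraph W} {S : Finset W} :
    S ∈ H.indepFinsets ↔ H.IsIndepSet (S : Set W) := by
  simp [indepFinsets]

-- The class of one distinguished color can be any independent set, and the other `t` colors
-- properly color its complement.
open Classical in
theorem card_coloring_succ [Fintype W] (H : SimpleGraph W) (t : ℕ) :
    Nat.card (H.Coloring (Fin (t + 1))) =
      ∑ S ∈ H.indepFinsets,
        Nat.card ((H.induce ((S : Set W)ᶜ)).Coloring (Fin t)) := by
  have e : H.Coloring (Fin (t + 1)) ≃ H.Coloring (Option (Fin t)) :=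
    { toFun := fun f => (Embedding.completeGraph (finSuccEquiv t).toEmbedding).toHom.comp f
      invFun := fun f => (Embedding.completeGraph (finSuccEquiv t).symm.toEmbedding).toHom.comp f
      left_inv := fun f => RelHom.ext fun w => (finSuccEquiv t).symm_apply_apply (f w)
      right_inv := fun f => RelHom.ext fun w => (finSuccEquiv t).apply_symm_apply (f w) }
  have := Fintype.ofFinite (H.Coloring (Option (Fin t)))
  rw [Nat.card_congr e, Nat.card_eq_fintype_card, ← Finset.card_univ,
    Finset.card_eq_sum_card_fiberwise
      (f := fun f : H.Coloring (Option (Fin t)) => Finset.univ.filter fun w => f w = none)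
      (t := H.indepFinsets)]
  · refine Finset.sum_congr rfl fun S hS => ?_
    rw [← Nat.card_congr (H.coloringOptionEquiv (Fin t) S (mem_indepFinsets.1 hS)),
      Nat.card_eq_fintype_card, Fintype.card_subtype]
    congr 1
    ext f
    simp [Finset.ext_iff]
  · intro f _
    refine mem_indepFinsets.2 fun u hu v hv _ huv => f.valid huv ?_
    exact (Finset.mem_filter.1 hu).2.trans (Finset.mem_filter.1 hv).2.symm

/-- The clique complex of a graph. -/
def cliqueComplex (H : SimpleGraph W) : AbstractSimplicialComplex W where
  faces := {X | X.Nonempty ∧ H.IsClique (X : Set W)}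
  isRelLowerSet_faces := fun _ hX =>
    ⟨hX.1, fun _ hYX hY => ⟨hY, hX.2.subset (Finset.coe_subset.2 hYX)⟩⟩
  singleton_mem v := ⟨Finset.singleton_nonempty v, by simp⟩

/-- Lets proper colorings inherit polynomiality from simplicial colorings. -/
theorem isSimplicialColoring_cliqueComplex_one {C : Type*} [DecidableEq C] (H : SimpleGraph W)
    (f : W → C) :
    H.cliqueComplex.IsSimplicialColoring 1 f ↔ ∀ u v, H.Adj u v → f u ≠ f v := by
  classical
  constructor
  · intro h u v huv hf
    have hX : ({u, v} : Finset W) ∈ H.cliqueComplex.faces :=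
      ⟨Finset.insert_nonempty _ _, by
        simp only [Finset.coe_insert, Finset.coe_singleton]
        rw [isClique_pair]
        exact fun _ => huv⟩
    have := Finset.card_le_one.1 (h _ hX (f v)) u (by simp [hf]) v (by simp)
    exact huv.ne this
  · rintro h X hX i
    refine Finset.card_le_one.2 fun u hu v hv => ?_
    rw [Finset.mem_filter] at hu hv
    by_contra huv
    exact h u v (hX.2 hu.1 hv.1 huv) (hu.2.trans hv.2.symm)

/-- The number of proper colorings is a polynomial function of the number of colors. -/
theorem exists_polynomial_card_coloring [Finite W] (H : SimpleGraph W) :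
    ∃ p : Polynomial ℤ, ∀ t : ℕ, p.eval (t : ℤ) = (Nat.card (H.Coloring (Fin t)) : ℤ) := by
  obtain ⟨p, hp⟩ := H.cliqueComplex.exists_polynomial_numSimplicialColorings 1
  refine ⟨p, fun t => (hp t).trans ?_⟩
  rw [AbstractSimplicialComplex.numSimplicialColorings]
  congr 1
  exact Nat.card_congr
    { toFun := fun f => Coloring.mk f.1 fun {u v} huv =>
        (H.isSimplicialColoring_cliqueComplex_one f.1).1 f.2 u v huv
      invFun := fun g => ⟨g, (H.isSimplicialColoring_cliqueComplex_one g).2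
        fun _ _ huv => g.valid huv⟩
      left_inv := fun _ => rfl
      right_inv := fun _ => rfl }

/-! ### Acyclic orientations and sinks -/

/-- `D` is an acyclic orientation of `H`. -/
def IsAcyclicOrientation (H : SimpleGraph W) (D : Digraph W) : Prop :=
  H.IsOrientation D ∧ ∀ v, ¬ Relation.TransGen D.Adj v v

/-- `v` is a sink of `D`. -/
def _root_.Digraph.IsSink (D : Digraph W) (v : W) : Prop := ∀ w, ¬ D.Adj v w

/-- The digraph in which every vertex of `S` is a sink, extending the digraph `D` on the
complement of `S` by all edges of `H` going into `S`. -/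
def extendBySinks (H : SimpleGraph W) (S : Set W) (D : Digraph ↥(Sᶜ)) : Digraph W where
  Adj u v := u ∉ S ∧ v ∈ S ∧ H.Adj u v ∨ ∃ hu hv, D.Adj ⟨u, hu⟩ ⟨v, hv⟩

/-- No arc leaves `S`, so a directed path ending outside `S` never meets it. Hence the extension
creates no directed cycle. -/
theorem transGen_of_extendBySinks {H : SimpleGraph W} {S : Set W} {D : Digraph ↥(Sᶜ)} {u v : W}
    (h : Relation.TransGen (H.extendBySinks S D).Adj u v) (hv : v ∉ S) :
    ∃ hu, Relation.TransGen D.Adj ⟨u, hu⟩ ⟨v, hv⟩ := by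
  induction h using Relation.TransGen.head_induction_on with
  | single h =>
    rcases h with h | ⟨hu, hv, h⟩
    · exact absurd h.2.1 hv
    · exact ⟨hu, .single h⟩
  | head h _ ih =>
    obtain ⟨hc, ih⟩ := ih
    rcases h with h | ⟨hu, hv, h⟩
    · exact absurd h.2.1 hc
    · exact ⟨hu, .head h ih⟩

theorem isAcyclicOrientation_extendBySinks {H : SimpleGraph W} {S : Set W}
    (hS : H.IsIndepSet S) {D : Digraph ↥(Sᶜ)} (hD : (H.induce Sᶜ).IsAcyclicOrientation D) :
    H.IsAcyclicOrientation (H.extendBySinks S D) := by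
  refine ⟨⟨?_, ?_⟩, ?_⟩
  · rintro u v (h | ⟨hu, hv, h⟩)
    · exact h.2.2
    · exact hD.1.1 _ _ h
  · intro u v huv
    by_cases hu : u ∈ S <;> by_cases hv : v ∈ S
    · exact absurd huv (hS hu hv huv.ne)
    · exact Or.inr ⟨Or.inl ⟨hv, hu, huv.symm⟩, by
        rintro (h | ⟨h, _⟩)
        · exact h.1 hu
        · exact h hu⟩
    · exact Or.inl ⟨Or.inl ⟨hu, hv, huv⟩, by
        rintro (h | ⟨h, _⟩)
        · exact h.1 hv
        · exact h hv⟩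
    · have key : ∀ a b (ha : a ∉ S) (hb : b ∉ S),
          (H.extendBySinks S D).Adj a b ↔ D.Adj ⟨a, ha⟩ ⟨b, hb⟩ := fun a b ha hb =>
        ⟨fun h => h.elim (fun h => absurd h.2.1 hb) fun ⟨_, _, h⟩ => h,
          fun h => Or.inr ⟨ha, hb, h⟩⟩
      rw [key u v hu hv, key v u hv hu]
      exact hD.1.2 ⟨u, hu⟩ ⟨v, hv⟩ huv
  · intro v h
    have hv : v ∉ S := by
      obtain ⟨w, h, -⟩ := Relation.TransGen.head'_iff.1 h
      rcases h with h | ⟨h, _⟩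
      · exact h.1
      · exact h
    obtain ⟨_, h⟩ := transGen_of_extendBySinks h hv
    exact hD.2 _ h

/-- Acyclic orientations of `H` for which all vertices of the independent set `S` are sinks
correspond to acyclic orientations of the graph induced on the complement of `S`. -/
def acyclicOrientationSinksEquiv (H : SimpleGraph W) (S : Set W) (hS : H.IsIndepSet S) :
    {D : Digraph W // H.IsAcyclicOrientation D ∧ ∀ v ∈ S, D.IsSink v} ≃
      {D : Digraph ↥(Sᶜ) // (H.induce Sᶜ).IsAcyclicOrientation D} where
  toFun D := ⟨⟨fun u v => D.1.Adj u v⟩,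
    ⟨fun u v h => D.2.1.1.1 u v h, fun u v h => D.2.1.1.2 u v h⟩,
    fun v h => D.2.1.2 v (h.lift Subtype.val fun _ _ h => h)⟩
  invFun D := ⟨H.extendBySinks S D.1, isAcyclicOrientation_extendBySinks hS D.2, by
    rintro v hv w (h | ⟨h, _⟩)
    · exact h.1 hv
    · exact h hv⟩
  left_inv D := by
    apply Subtype.ext
    ext u v
    constructor
    · rintro (⟨hu, hv, h⟩ | ⟨_, _, h⟩)
      · exact (D.2.1.1.2 u v h).elim And.left fun h => absurd h.1 (D.2.2 v hv u)
      · exact h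
    · intro h
      have hu : u ∉ S := fun hu => D.2.2 u hu v h
      by_cases hv : v ∈ S
      · exact Or.inl ⟨hu, hv, D.2.1.1.1 u v h⟩
      · exact Or.inr ⟨hu, hv, h⟩
  right_inv D := by
    apply Subtype.ext
    ext u v
    constructor
    · rintro (h | ⟨_, _, h⟩)
      · exact absurd h.2.1 v.2
      · exact h
    · exact fun h => Or.inr ⟨u.2, v.2, h⟩

/-- Acyclicity makes reachability a strict order; on a finite set it has an extremal vertex, from
which nothing is reachable. -/
theorem IsAcyclicOrientation.exists_isSink [Finite W] [Nonempty W] {H : SimpleGraph W}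
    {D : Digraph W} (hD : H.IsAcyclicOrientation D) : ∃ v, D.IsSink v := by
  let r : W → W → Prop := fun u v => Relation.TransGen D.Adj v u
  have : IsTrans W r := ⟨fun _ _ _ h h' => Relation.TransGen.trans h' h⟩
  have : Std.Irrefl r := ⟨hD.2⟩
  obtain ⟨v, -, hv⟩ := (Finite.wellFounded_of_trans_of_irrefl r).has_min Set.univ Set.univ_nonempty
  exact ⟨v, fun w h => hv w trivial (.single h)⟩

theorem numAcyclicOrientations_of_isEmpty [IsEmpty W] (H : SimpleGraph W) :
    H.numAcyclicOrientations = 1 := by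
  rw [numAcyclicOrientations, Nat.card_eq_one_iff_unique]
  exact ⟨⟨fun D D' => Subtype.ext (Digraph.ext (funext isEmptyElim))⟩,
    ⟨⟨⟨fun _ _ => False⟩, ⟨isEmptyElim, isEmptyElim⟩, isEmptyElim⟩⟩⟩

-- The number `a(H - S)` counts the acyclic orientations of `H` whose sinks include `S`. After
-- exchanging the sums, each orientation contributes an alternating sum over subsets of its sink
-- set, which vanishes unless that set is empty.
open Classical in
theorem sum_numAcyclicOrientations_induce_compl [Fintype W] (H : SimpleGraph W) :
    ∑ S ∈ H.indepFinsets,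
      (-1 : ℤ) ^ S.card * ((H.induce ((S : Set W)ᶜ)).numAcyclicOrientations : ℤ) =
        if IsEmpty W then 1 else 0 := by
  let A : Finset (Digraph W) := Finset.univ.filter H.IsAcyclicOrientation
  let sinks : Digraph W → Finset W := fun D => Finset.univ.filter D.IsSink
  have hcard : ∀ S : Finset W, H.IsIndepSet (S : Set W) →
      (H.induce ((S : Set W)ᶜ)).numAcyclicOrientations = (A.filter fun D => S ⊆ sinks D).card := by
    intro S hS
    refine (Nat.card_congr (H.acyclicOrientationSinksEquiv S hS)).symm.trans ?_
    rw [Nat.card_eq_fintype_card, Fintype.card_subtype, Finset.filter_filter]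
    congr 1
    ext D
    simp [sinks, Finset.subset_iff]
  -- Adjacent vertices cannot both be sinks, so independence of `S` is automatic.
  have hindep : ∀ D ∈ A, ∀ S : Finset W, S ⊆ sinks D → H.IsIndepSet (S : Set W) := by
    intro D hD S hS u hu v hv _ huv
    rcases (Finset.mem_filter.1 hD).2.1.2 u v huv with h | h
    · exact (Finset.mem_filter.1 (hS hu)).2 v h.1
    · exact (Finset.mem_filter.1 (hS hv)).2 u h.1
  calc
    _ = ∑ S ∈ H.indepFinsets, ∑ D ∈ A,
          if S ⊆ sinks D then (-1 : ℤ) ^ S.card else 0 := by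
      refine Finset.sum_congr rfl fun S hS => ?_
      rw [hcard S (mem_indepFinsets.1 hS), ← Finset.sum_filter, Finset.sum_const,
        nsmul_eq_mul, mul_comm]
    _ = ∑ D ∈ A, ∑ S ∈ (sinks D).powerset, (-1 : ℤ) ^ S.card := by
      rw [Finset.sum_comm]
      refine Finset.sum_congr rfl fun D hD => ?_
      rw [← Finset.sum_filter]
      refine Finset.sum_congr ?_ fun _ _ => rfl
      ext S
      rw [Finset.mem_filter, Finset.mem_powerset, mem_indepFinsets]
      exact ⟨And.right, fun h => ⟨hindep D hD S h, h⟩⟩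
    _ = ∑ D ∈ A, if IsEmpty W then 1 else 0 := by
      refine Finset.sum_congr rfl fun D hD => ?_
      rw [Finset.sum_powerset_neg_one_pow_card]
      congr 1
      rw [eq_iff_iff, ← not_iff_not, ← ne_eq, ← Finset.nonempty_iff_ne_empty, not_isEmpty_iff]
      refine ⟨fun ⟨v, _⟩ => ⟨v⟩, fun _ => ?_⟩
      obtain ⟨v, hv⟩ := (Finset.mem_filter.1 hD).2.exists_isSink
      exact ⟨v, Finset.mem_filter.2 ⟨Finset.mem_univ v, hv⟩⟩
    _ = _ := by
      split_ifs with h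
      · have : A.card = H.numAcyclicOrientations := by
          rw [numAcyclicOrientations, Nat.card_eq_fintype_card, Fintype.card_subtype]
          congr 1
          ext D
          simp [A, IsAcyclicOrientation]
        rw [Finset.sum_const, this, numAcyclicOrientations_of_isEmpty, one_smul]
      · simp

end SimpleGraph

/-! ### Stanley's theorem -/

namespace SimpleGraph

/-- Stanley's theorem: up to sign, the chromatic polynomial at `-1` counts the acyclic
orientations. -/
theorem eval_neg_one_eq_numAcyclicOrientations {W : Type*} [Finite W] (H : SimpleGraph W)
    (p : Polynomial ℤ) (hp : ∀ t : ℕ, p.eval (t : ℤ) = (Nat.card (H.Coloring (Fin t)) : ℤ)) :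
    p.eval (-1) = (-1) ^ Nat.card W * (H.numAcyclicOrientations : ℤ) := by
  classical
  induction hn : Nat.card W using Nat.strong_induction_on generalizing W p with
  | _ n ih =>
  have := Fintype.ofFinite W
  choose q hq using fun S : Finset W => (H.induce ((S : Set W)ᶜ)).exists_polynomial_card_coloring
  have hrec : p.comp (Polynomial.X + 1) = ∑ S ∈ H.indepFinsets, q S := by
    refine Polynomial.eq_of_infinite_eval_eq _ _ (Set.Infinite.mono ?_
      (Set.infinite_range_of_injective (f := fun t : ℕ => (t : ℤ)) Nat.cast_injective))
    rintro _ ⟨t, rfl⟩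
    have := hp (t + 1)
    rw [card_coloring_succ] at this
    simpa [Polynomial.eval_finsetSum, hq] using this
  have hzero : p.eval 0 = if IsEmpty W then 1 else 0 := by
    have h0 := hp 0
    rw [Nat.cast_zero] at h0
    rw [h0]
    split_ifs with h
    · have : Unique (H.Coloring (Fin 0)) :=
        { default := Coloring.mk isEmptyElim (fun {v} => isEmptyElim v)
          uniq := fun f => RelHom.ext isEmptyElim }
      simp
    · obtain ⟨w⟩ := not_isEmpty_iff.1 h
      have : IsEmpty (H.Coloring (Fin 0)) := ⟨fun f => (f w).elim0⟩
      simp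
  have hempty : (∅ : Finset W) ∈ H.indepFinsets := mem_indepFinsets.2 (by simp)
  -- The recursion at `t = -1` relates values at `-1` to `p(0)`, the number of colorings without
  -- colors.
  have hp1 : ∑ S ∈ H.indepFinsets, (q S).eval (-1) = if IsEmpty W then 1 else 0 := by
    rw [← Polynomial.eval_finsetSum, ← hrec, ← hzero]
    simp
  have ha := H.sum_numAcyclicOrientations_induce_compl
  have e : H.induce (((∅ : Finset W) : Set W)ᶜ) ≃g H :=
    { toEquiv := Equiv.subtypeUnivEquiv (by simp)
      map_rel_iff' := Iff.rfl }
  have hq0 : q ∅ = p := by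
    refine Polynomial.eq_of_infinite_eval_eq _ _ (Set.Infinite.mono ?_
      (Set.infinite_range_of_injective (f := fun t : ℕ => (t : ℤ)) Nat.cast_injective))
    rintro _ ⟨t, rfl⟩
    refine (hq ∅ t).trans (Eq.trans ?_ (hp t).symm)
    congr 1
    exact Nat.card_congr
      { toFun := fun f => f.comp e.symm.toHom
        invFun := fun f => f.comp e.toHom
        left_inv := fun f => RelHom.ext fun w => congrArg f (e.symm_apply_apply w)
        right_inv := fun f => RelHom.ext fun w => congrArg f (e.apply_symm_apply w) }
  have ha0 : (H.induce (((∅ : Finset W) : Set W)ᶜ)).numAcyclicOrientations =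
      H.numAcyclicOrientations := by
    refine (Nat.card_congr (H.acyclicOrientationSinksEquiv _ (by simp))).symm.trans ?_
    exact Nat.card_congr (Equiv.subtypeEquivRight fun D => by simp [IsAcyclicOrientation])
  rw [← Finset.add_sum_erase _ _ hempty, hq0] at hp1
  rw [← Finset.add_sum_erase _ _ hempty, ha0, Finset.card_empty, pow_zero, one_mul] at ha
  have hind : ∀ S ∈ H.indepFinsets.erase ∅, (q S).eval (-1) =
      (-1) ^ n * ((-1) ^ S.card * ((H.induce ((S : Set W)ᶜ)).numAcyclicOrientations : ℤ)) := by
    intro S hS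
    have hpos : 0 < S.card := Finset.card_pos.2
      (Finset.nonempty_iff_ne_empty.2 (Finset.ne_of_mem_erase hS))
    have hcard : Nat.card ↥((S : Set W)ᶜ) + S.card = n := by
      have := Set.ncard_add_ncard_compl (S : Set W)
      rw [Set.ncard_coe_finset, hn, ← Nat.card_coe_set_eq] at this
      omega
    rw [ih _ (by omega) _ (q S) (hq S) rfl, ← mul_assoc, ← hcard, pow_add, mul_assoc _ _ (_ ^ _),
      ← mul_pow, neg_one_mul, neg_neg, one_pow, mul_one]
  rw [Finset.sum_congr rfl hind, ← Finset.mul_sum] at hp1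
  -- The sign is harmless: the right side is nonzero only when `n = 0`.
  have hsign : (if IsEmpty W then 1 else 0 : ℤ) = (-1) ^ n * if IsEmpty W then 1 else 0 := by
    split_ifs
    · rw [← hn, Nat.card_of_isEmpty, pow_zero, one_mul]
    · rw [mul_zero]
  linear_combination hp1 + hsign - (-1) ^ n * ha

/-! ### Flats and monochromatic edges -/

variable {V : Type*} {α : Type*} {G : SimpleGraph V}

/-- The edges of `G` whose two ends have the same color. -/
def monochromaticEdges (G : SimpleGraph V) (f : V → α) : Set (Sym2 V) :=
  G.edgeSet ∩ {e | (e.map f).IsDiag}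

theorem mk_mem_monochromaticEdges {f : V → α} {u v : V} :
    s(u, v) ∈ G.monochromaticEdges f ↔ G.Adj u v ∧ f u = f v := by
  simp [monochromaticEdges]

theorem eq_of_reachable_monochromaticEdges {f : V → α} {u v : V}
    (h : (fromEdgeSet (G.monochromaticEdges f)).Reachable u v) : f u = f v := by
  obtain ⟨p⟩ := h
  induction p with
  | nil => rfl
  | cons h _ ih => exact (mk_mem_monochromaticEdges.1 h.1).2.trans ih

/-- Color is constant along monochromatic paths, so every edge of `G` within a component is
monochromatic. -/
theorem isFlat_monochromaticEdges (G : SimpleGraph V) (f : V → α) :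
    G.IsFlat (G.monochromaticEdges f) := by
  refine ⟨Set.inter_subset_left, fun C => ?_⟩
  ext ⟨u, hu⟩ ⟨v, hv⟩
  rw [comap_adj, comap_adj]
  refine ⟨fun h => h.1.1, fun h => ⟨mk_mem_monochromaticEdges.2 ⟨h, ?_⟩, h.ne⟩⟩
  exact eq_of_reachable_monochromaticEdges (ConnectedComponent.exact (hu.trans hv.symm))

theorem IsFlat.mk_mem_iff {F : Set (Sym2 V)} (hF : G.IsFlat F) {u v : V} :
    s(u, v) ∈ F ↔ G.Adj u v ∧ (fromEdgeSet F).connectedComponentMk u =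
      (fromEdgeSet F).connectedComponentMk v := by
  constructor
  · intro h
    have huv : G.Adj u v := hF.1 h
    exact ⟨huv, ConnectedComponent.sound (Adj.reachable ⟨h, huv.ne⟩)⟩
  · rintro ⟨huv, h⟩
    have h' := congrArg (fun K => K.Adj ⟨u, h⟩ ⟨v, rfl⟩)
      (hF.2 ((fromEdgeSet F).connectedComponentMk v))
    simp only [comap_adj, eq_iff_iff] at h'
    exact (h'.2 huv).1

/-- Colorings whose set of monochromatic edges is the flat `F` correspond to proper colorings of
the contraction of `F`. -/
def IsFlat.coloringEquiv {F : Set (Sym2 V)} (hF : G.IsFlat F) (α : Type*) :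
    {f : V → α // G.monochromaticEdges f = F} ≃ (G.contractEdges F).Coloring α where
  toFun f := Coloring.mk
    (ConnectedComponent.lift f.1 fun u v p _ =>
      eq_of_reachable_monochromaticEdges (G := G) (by rw [f.2]; exact ⟨p⟩)) (by
    rintro _ _ ⟨hne, u, v, huv, rfl, rfl⟩ h
    -- Equal colors would put the edge in `F`, merging the two components.
    refine hne (hF.mk_mem_iff.1 ?_).2
    rw [← f.2]
    exact mk_mem_monochromaticEdges.2 ⟨huv, h⟩)
  invFun g := ⟨fun v => g ((fromEdgeSet F).connectedComponentMk v), by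
    ext e
    induction e with
    | _ u v =>
      rw [mk_mem_monochromaticEdges, hF.mk_mem_iff]
      refine and_congr_right fun huv => ⟨fun h => ?_, fun h => congrArg g h⟩
      by_contra hne
      exact g.valid (map_adj_apply' huv hne) h⟩
  left_inv f := rfl
  right_inv g := by
    apply RelHom.ext
    intro C
    induction C using ConnectedComponent.ind
    rfl

end SimpleGraph

/-! ### Simplicial colorings sorted by flats -/

namespace AbstractSimplicialComplex

theorem dim_lt_iff {V : Type*} [Finite V] (Γ : AbstractSimplicialComplex V) (s : ℕ) :
    Γ.dim < (s : ℤ) ↔ ∀ X ∈ Γ.faces, X.card ≤ s := by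
  have hb : BddAbove (Finset.card '' Γ.faces) := (Set.toFinite _).bddAbove
  have h : Γ.dim < (s : ℤ) ↔ sSup (Finset.card '' Γ.faces) ≤ s := by
    rw [dim]
    omega
  rw [h]
  refine ⟨fun h X hX => (le_csSup hb ⟨X, hX, rfl⟩).trans h, fun h => ?_⟩
  -- Without faces the supremum in `ℕ` is `0`.
  rcases (Finset.card '' Γ.faces).eq_empty_or_nonempty with he | hne
  · simp [he]
  · exact csSup_le hne (by rintro _ ⟨X, hX, rfl⟩; exact h X hX)

theorem adj_oneSkeleton_of_mem {V : Type*} [DecidableEq V] {Γ : AbstractSimplicialComplex V}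
    {X : Finset V} (hX : X ∈ Γ.faces) {u v : V} (hu : u ∈ X) (hv : v ∈ X) (huv : u ≠ v) :
    Γ.oneSkeleton.Adj u v :=
  ⟨huv, (Γ.isRelLowerSet_faces hX).2 (Finset.insert_subset hu (Finset.singleton_subset_iff.2 hv))
    (Finset.insert_nonempty _ _)⟩

/-- The faces of the subcomplex are exactly the monochromatic faces of `Γ`, because any two vertices
of a face are adjacent in the 1-skeleton. Each nonempty color class in a face is such a face. -/
theorem isSimplicialColoring_iff_dim_lt {V C : Type*} [Finite V] [DecidableEq V] [DecidableEq C]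
    (Γ : AbstractSimplicialComplex V) (s : ℕ) (f : V → C) :
    Γ.IsSimplicialColoring s f ↔
      (Γ.edgeSubcomplex (Γ.oneSkeleton.monochromaticEdges f)).dim < (s : ℤ) := by
  rw [dim_lt_iff]
  constructor
  · rintro h X ⟨hX, hF⟩
    obtain ⟨a, ha⟩ := (Γ.isRelLowerSet_faces hX).1
    refine le_trans (le_of_eq ?_) (h X hX (f a))
    rw [Finset.filter_true_of_mem]
    intro v hv
    by_cases hva : v = a
    · rw [hva]
    · exact (SimpleGraph.mk_mem_monochromaticEdges.1 (hF v hv a ha hva)).2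
  · intro h X hX i
    rcases (X.filter fun v => f v = i).eq_empty_or_nonempty with he | hne
    · simp [he]
    · have hY := (Γ.isRelLowerSet_faces hX).2 (Finset.filter_subset _ X) hne
      refine h _ ⟨hY, fun u hu v hv huv => SimpleGraph.mk_mem_monochromaticEdges.2
        ⟨adj_oneSkeleton_of_mem hY hu hv huv, ?_⟩⟩
      exact (Finset.mem_filter.1 hu).2.trans (Finset.mem_filter.1 hv).2.symm

theorem numSimplicialColorings_eq_sum {V : Type*} [Finite V] [DecidableEq V]
    (Γ : AbstractSimplicialComplex V) (s t : ℕ) :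
    Γ.numSimplicialColorings s t =
      ∑ F ∈ Γ.oneSkeleton.flats with (Γ.edgeSubcomplex F).dim < (s : ℤ),
        Nat.card ((Γ.oneSkeleton.contractEdges F).Coloring (Fin t)) := by
  classical
  have := Fintype.ofFinite V
  rw [numSimplicialColorings, Nat.card_eq_fintype_card, Fintype.card_subtype,
    Finset.card_eq_sum_card_fiberwise (f := fun f : V → Fin t => Γ.oneSkeleton.monochromaticEdges f)
      (t := Γ.oneSkeleton.flats.filter fun F => (Γ.edgeSubcomplex F).dim < (s : ℤ))]
  · refine Finset.sum_congr rfl fun F hF => ?_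
    rw [Finset.mem_filter, SimpleGraph.flats, Set.Finite.mem_toFinset] at hF
    obtain ⟨hflat, hdim⟩ := hF
    rw [← Nat.card_congr (SimpleGraph.IsFlat.coloringEquiv hflat (Fin t)),
      Nat.card_eq_fintype_card, Fintype.card_subtype, Finset.filter_filter]
    congr 1
    ext f
    simp only [Finset.mem_filter, Finset.mem_univ, true_and, isSimplicialColoring_iff_dim_lt]
    refine ⟨And.right, ?_⟩
    rintro rfl
    exact ⟨hdim, rfl⟩
  · intro f hf
    refine Finset.mem_coe.2 (Finset.mem_filter.2 ⟨?_, ?_⟩)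
    · rw [SimpleGraph.flats, Set.Finite.mem_toFinset]
      exact Γ.oneSkeleton.isFlat_monochromaticEdges f
    · exact (Γ.isSimplicialColoring_iff_dim_lt s f).1 (Finset.mem_filter.1 hf).2

end AbstractSimplicialComplex

theorem mainTheorem2 {V : Type*} [Finite V] [DecidableEq V]
    (Γ : AbstractSimplicialComplex V) (s : ℕ) (hs : 1 ≤ s) :
    (Γ.sChromaticPolynomial s).eval (-1) =
      ∑ F ∈ Γ.oneSkeleton.flats with (Γ.edgeSubcomplex F).dim < (s : ℤ),
        (-1 : ℤ) ^ SimpleGraph.numComponents F *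
          ((Γ.oneSkeleton.contractEdges F).numAcyclicOrientations : ℤ) := by
  have hfin (F : Set (Sym2 V)) : Finite (SimpleGraph.fromEdgeSet F).ConnectedComponent :=
    Quot.finite _
  choose q hq using fun F : Set (Sym2 V) =>
    (Γ.oneSkeleton.contractEdges F).exists_polynomial_card_coloring
  rw [← Γ.eq_sChromaticPolynomial s
    (∑ F ∈ Γ.oneSkeleton.flats with (Γ.edgeSubcomplex F).dim < (s : ℤ), q F),
    Polynomial.eval_finsetSum]
  -- By definition, `numComponents F` is the number of vertices of the contraction.
  · exact Finset.sum_congr rfl fun F _ =>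
      SimpleGraph.eval_neg_one_eq_numAcyclicOrientations _ (q F) (hq F)
  · intro t _
    rw [Polynomial.eval_finsetSum, Γ.numSimplicialColorings_eq_sum, Nat.cast_sum]
    exact Finset.sum_congr rfl fun F _ => hq F t
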